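/- Let $p\equiv 1\pmod 4$ be a prime, $p=4R+1$, let $g$ be a primitive root modulo $p$, and for $k=0,1,2,3$ let $H_k=\{g^{k+4t} \bmod p : t=0,\dots,R-1\}$ be the cyclotomic classes of order four. For $k\in\{0,1\}$ and $l\in\{0,1,2,3\}$ put $$H_{k,l}=\{w\in\mathbb Z_{2p} : w \bmod 2 = k,\ w \bmod p\in H_l\},$$ and let $s$ be the quaternary sequence of period $2p$ given by $$s(t)=\begin{cases}0,& t \bmod 2p\in\{0\}\cup H_{0,0}\cup H_{1,2},\\ 1,& t \bmod 2p\in H_{0,2}\cup H_{1,0},\\ 2,& t \bmod 2p\in\{p\}\cup H_{0,1}\cup H_{1,3},\\ 3,& t \bmod 2p\in H_{0,3}\cup H_{1,1}.\end{cases}$$ For an integer $w$ let $R(w)=\sum_{n=0}^{2p-1} i^{\,s(n)-s(n+w)}$ be its periodic autocorrelation, where $i=\sqrt{-1}$. Write $p=x^2+4y^2$ with $x,y\in\mathbb Z$ and $x\equiv 1\pmod 4$. Then (i) if $p\equiv 5\pmod 8$, then $\max_{1\le w\le 2p-1}|R(w)|=\max|-2\pm 2y\pm 2i|$; (ii) if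 $p\equiv 1\pmod 8$, then $\max_{1\le w\le 2p-1}|R(w)|=\max|-4\pm 2y|$, where the maxima on the right-hand sides are taken over all choices of signs. -/

import Mathlib

namespace QuaternaryCyclotomic

/-- The cyclotomic class `H_k = {g ^ (k + 4 t) mod p : t = 0, ..., R - 1}` of order four, where
`p = 4 R + 1` and `g` is a primitive root modulo `p`. -/
def cycClass (p : ℕ) (g : ZMod p) (k : Fin 4) : Finset (ZMod p) :=
  (Finset.range ((p - 1) / 4)).image fun t => g ^ ((k : ℕ) + 4 * t)

/-- The set `H_{k,l} = f⁻¹({k} × H_l)`, where `f : ℤ/2p → ℤ/2 × ℤ/p` is reduction in both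
coordinates. -/
def cycClass₂ (p : ℕ) (g : ZMod p) (k : ZMod 2) (l : Fin 4) : Set (ZMod (2 * p)) :=
  {w | ZMod.castHom (dvd_mul_right 2 p) (ZMod 2) w = k ∧
    ZMod.castHom (dvd_mul_left p 2) (ZMod p) w ∈ cycClass p g l}

/-- The set `C_k = H_{0, j_k} ∪ H_{1, l_k}`. -/
def classC (p : ℕ) (g : ZMod p) (j l : Fin 4 → Fin 4) (k : Fin 4) : Set (ZMod (2 * p)) :=
  cycClass₂ p g 0 (j k) ∪ cycClass₂ p g 1 (l k)

open scoped Classical in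
/-- The quaternary sequence `s` attached to `(j_k)` and `(l_k)`: `s(t) = k` if `t mod 2p ∈ C_k`,
`s(t) = 0` if `t mod 2p = 0`, and `s(t) = 2` if `t mod 2p = p`. If `p = 4 R + 1` is prime, `g` is a
primitive root and `j`, `l` are injective, then the six cases are disjoint and exhaustive, so
neither their order nor the value in the last branch matters. -/
noncomputable def quatSeq (p : ℕ) (g : ZMod p) (j l : Fin 4 → Fin 4) (t : ℕ) : ℤ :=
  if (t : ZMod (2 * p)) = 0 then 0
  else if (t : ZMod (2 * p)) = (p : ZMod (2 * p)) then 2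
  else if (t : ZMod (2 * p)) ∈ classC p g j l 0 then 0
  else if (t : ZMod (2 * p)) ∈ classC p g j l 1 then 1
  else if (t : ZMod (2 * p)) ∈ classC p g j l 2 then 2
  else if (t : ZMod (2 * p)) ∈ classC p g j l 3 then 3
  else 0

/-- The periodic autocorrelation `R(w) = ∑_{n = 0}^{N - 1} i ^ (s(n) - s(n + w))` of a quaternary
sequence `s` of period `N`. -/
noncomputable def autocorr (N : ℕ) (s : ℕ → ℤ) (w : ℕ) : ℂ :=
  ∑ n ∈ Finset.range N, Complex.I ^ (s n - s (n + w))

/-- The set of magnitudes `|R(w)|`, `w = 1, ..., N - 1`. -/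
def nontrivialMagnitudes (N : ℕ) (s : ℕ → ℤ) : Set ℝ :=
  {r | ∃ w : ℕ, 0 < w ∧ w < N ∧ r = ‖autocorr N s w‖}

end QuaternaryCyclotomic

/-!
Let `χ` be the quartic character modulo `p` with `χ g = i`, and put `η = χ ^ 2` and
`κ = Re ((1 + i) χ)`, which are `±1`-valued away from `0`. In terms of the residues
`(a, v) ∈ ℤ/2 × ℤ/p` of `t`, the sequence is
`i ^ s(t) = (1 + i) / 2 * η v + (-1) ^ a * ((1 - i) / 2 * κ v + δ₀ v)`. Since `(-1) ^ a` sums to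
zero, the cross terms cancel in the autocorrelation, and
`R(w) = C_η(w) + (-1) ^ w * (C_κ(w) + (1 + i + (1 - i) χ(-1)) κ(w) + 2 δ₀(w))`,
where `C_f` is the autocorrelation of `f` on `ℤ/p`. For `w ≢ 0` mod `p` one has `C_η(w) = -1` and
`C_κ(w) = -1 - χ(-1) η(w) Im J(χ, χ)`. The Jacobi sum `J(χ, χ)` is a Gaussian integer of norm `p`
with even imaginary part, so `|Im J(χ, χ)| = 2 |y|` by uniqueness of `p = x ^ 2 + 4 y ^ 2`. The
maximum is attained at an even `w` with `κ(w) = -1` and a suitable sign `η(w)`.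
-/

namespace QuaternaryCyclotomic

open Complex Finset

section Correlation

variable {A G R : Type*} [AddCommGroup A] [Fintype A] [AddCommGroup G] [Fintype G]
  [CommSemiring R] [StarRing R]

/-- The periodic cross-correlation `w ↦ ∑ v, f v * conj (h (v + w))` of two functions on a finite
abelian group. The shift is in the conjugated argument, as in `autocorr`. -/
def correlation (f h : G → R) (w : G) : R := ∑ v, f v * star (h (v + w))

theorem correlation_add_left (f₁ f₂ h : G → R) (w : G) :
    correlation (f₁ + f₂) h w = correlation f₁ h w + correlation f₂ h w := by
  simp only [correlation, Pi.add_apply, add_mul, sum_add_distrib]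

theorem correlation_add_right (f h₁ h₂ : G → R) (w : G) :
    correlation f (h₁ + h₂) w = correlation f h₁ w + correlation f h₂ w := by
  simp only [correlation, Pi.add_apply, star_add, mul_add, sum_add_distrib]

theorem correlation_smul_left (c : R) (f h : G → R) (w : G) :
    correlation (c • f) h w = c * correlation f h w := by
  simp only [correlation, Pi.smul_apply, smul_eq_mul, mul_assoc, mul_sum]

theorem correlation_smul_right (c : R) (f h : G → R) (w : G) :
    correlation f (c • h) w = star c * correlation f h w := by
  simp only [correlation, Pi.smul_apply, smul_eq_mul, star_mul', mul_left_comm, mul_sum]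

theorem correlation_single_left [DecidableEq G] (a : G) (h : G → R) (w : G) :
    correlation (Pi.single a 1) h w = star (h (a + w)) := by
  simp [correlation, Pi.single_apply]

theorem correlation_single_right [DecidableEq G] (f : G → R) (a w : G) :
    correlation f (Pi.single a 1) w = f (a - w) := by
  simp [correlation, Pi.single_apply, apply_ite star, ← eq_sub_iff_add_eq]

theorem correlation_comp_addEquiv (e : A ≃+ G) (f h : G → R) (w : A) :
    correlation (f ∘ e) (h ∘ e) w = correlation f h (e w) := by
  simp only [correlation, Function.comp_apply, map_add]
  exact e.toEquiv.sum_comp fun v => f v * star (h (v + e w))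

/-- The cross terms between `f` and `ψ * h` cancel because `ψ` sums to zero. -/
theorem correlation_prod_addChar {ψ : AddChar A ℂ} (hψ : ψ ≠ 1) (f h : G → ℂ) (b : A) (w : G) :
    correlation (fun x : A × G => f x.2 + ψ x.1 * h x.2) (fun x => f x.2 + ψ x.1 * h x.2) (b, w) =
      Fintype.card A * (correlation f f w + star (ψ b) * correlation h h w) := by
  have hψ_sum : ∑ a, ψ a = 0 := AddChar.sum_eq_zero_of_ne_one hψ
  have hψ_star (a : A) : ψ a * star (ψ a) = 1 := by
    rw [RCLike.star_def, ← AddChar.map_neg_eq_conj, ← AddChar.map_add_eq_mul, add_neg_cancel,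
      AddChar.map_zero_eq_one]
  have hterm (a : A) (v : G) :
      (f v + ψ a * h v) * star (f (v + w) + ψ (a + b) * h (v + w)) =
        f v * star (f (v + w)) + star (ψ b) * (h v * star (h (v + w))) +
          (star (ψ a) * (star (ψ b) * (f v * star (h (v + w)))) +
            ψ a * (h v * star (f (v + w)))) := by
    rw [star_add, star_mul', AddChar.map_add_eq_mul, star_mul']
    linear_combination (star (ψ b) * (h v * star (h (v + w)))) * hψ_star a
  simp only [correlation, Fintype.sum_prod_type, Prod.mk_add_mk, hterm, sum_add_distrib,
    ← mul_sum, ← sum_mul, ← star_sum, hψ_sum, star_zero, zero_mul, add_zero, sum_const,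
    card_univ, nsmul_eq_mul]
  ring

theorem autocorr_eq_correlation {N : ℕ} [NeZero N] {s : ℕ → ℤ} {u : ZMod N → ℂ}
    (hu : ∀ n : ℕ, I ^ s n = u n) (w : ℕ) : autocorr N s w = correlation u u w := by
  have hterm (n : ℕ) : I ^ (s n - s (n + w)) = u n * star (u (n + w : ℕ)) := by
    rw [← hu, ← hu, RCLike.star_def, map_zpow₀, conj_I, ← inv_I, inv_zpow, ← div_eq_mul_inv,
      zpow_sub₀ I_ne_zero]
  rw [autocorr, correlation]
  refine sum_bij (fun n _ => (n : ZMod N)) (fun _ _ => mem_univ _) (fun a ha b hb hab => ?_)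
    (fun v _ => ⟨v.val, mem_range.mpr v.val_lt, ZMod.natCast_zmod_val v⟩) fun n _ => ?_
  · exact ((ZMod.natCast_eq_natCast_iff _ _ _).mp hab).eq_of_lt_of_lt (mem_range.mp ha)
      (mem_range.mp hb)
  · rw [hterm, Nat.cast_add]

end Correlation

section JacobiSum

variable {F : Type*} [Field F] [Fintype F]

theorem correlation_mulChar (φ ψ : MulChar F ℂ) {w : F} (hw : w ≠ 0) :
    correlation φ ψ w = φ (-1) * (φ w * ψ⁻¹ w) * jacobiSum φ ψ⁻¹ := by
  rw [correlation, jacobiSum, mul_sum,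
    ← Equiv.sum_comp (Equiv.mulLeft₀ (-w) (neg_ne_zero.mpr hw))]
  refine sum_congr rfl fun s _ => ?_
  have hshift : -w * s + w = w * (1 - s) := by ring
  have hscale : -w * s = -1 * w * s := by ring
  rw [Equiv.mulLeft₀_apply, MulChar.star_apply']
  beta_reduce
  rw [hshift, hscale]
  simp only [map_mul]
  ring

theorem correlation_mulChar_self {χ : MulChar F ℂ} (hχ : χ ≠ 1) {w : F} (hw : w ≠ 0) :
    correlation χ χ w = -1 := by
  have hχw : χ w * χ⁻¹ w = 1 := by
    rw [← MulChar.mul_apply, mul_inv_cancel, MulChar.one_apply hw.isUnit]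
  have hχ_neg : χ (-1) * χ (-1) = 1 := by rw [← map_mul, neg_mul_neg, one_mul, map_one]
  rw [correlation_mulChar χ χ hw, jacobiSum_nontrivial_inv hχ, hχw]
  linear_combination -hχ_neg

theorem jacobiSum_inv_inv (χ ψ : MulChar F ℂ) :
    jacobiSum χ⁻¹ ψ⁻¹ = star (jacobiSum χ ψ) := by
  rw [← MulChar.star_eq_inv, ← MulChar.star_eq_inv]
  exact jacobiSum_ringHomComp χ ψ (starRingEnd ℂ)

theorem jacobiSum_mul_star {χ ψ : MulChar F ℂ} (hχ : χ ≠ 1) (hψ : ψ ≠ 1) (hχψ : χ * ψ ≠ 1) :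
    jacobiSum χ ψ * star (jacobiSum χ ψ) = Fintype.card F := by
  have hchar : ringChar ℂ ≠ ringChar F := by
    rw [ringChar.eq_zero]
    exact (CharP.ringChar_ne_zero_of_finite F).symm
  rw [← jacobiSum_inv_inv, jacobiSum_mul_jacobiSum_inv hchar hχ hψ hχψ]

theorem exists_gaussianInt_of_mem_adjoin_I {z : ℂ} (hz : z ∈ Algebra.adjoin ℤ {I}) :
    ∃ m : GaussianInt, (m : ℂ) = z := by
  have hle : Algebra.adjoin ℤ {I} ≤ GaussianInt.toComplex.toIntAlgHom.range :=
    Algebra.adjoin_le (by rintro _ rfl; exact ⟨⟨0, 1⟩, by simp [GaussianInt.toComplex_def]⟩)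
  exact hle hz

end JacobiSum

theorem sq_eq_sq_of_prime_eq_sq_add_mul_sq {p : ℕ} (hp : p.Prime) {d a b x y : ℤ} (hd : 2 ≤ d)
    (hab : (p : ℤ) = a ^ 2 + d * b ^ 2) (hxy : (p : ℤ) = x ^ 2 + d * y ^ 2) : b ^ 2 = y ^ 2 := by
  have hp_pos : (0 : ℤ) < p := mod_cast hp.pos
  have hfactor : (a * y + b * x) * (a * y + -b * x) = p * (y ^ 2 - b ^ 2) := by
    linear_combination b ^ 2 * hxy - y ^ 2 * hab
  have eq_zero_of_dvd {c : ℤ} (hc : (p : ℤ) = a ^ 2 + d * c ^ 2) (hdvd : (p : ℤ) ∣ a * y + c * x) :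
      a * y + c * x = 0 := by
    obtain ⟨k, hk⟩ := hdvd
    have hbrahmagupta : (p : ℤ) ^ 2 = (a * x - d * c * y) ^ 2 + d * (a * y + c * x) ^ 2 := by
      linear_combination (p : ℤ) * hc + (a ^ 2 + d * c ^ 2) * hxy
    have hk_zero : k = 0 := by
      by_contra hk_ne
      have hk_sq : 0 < k ^ 2 := by positivity
      have : (p : ℤ) ^ 2 * 1 < p ^ 2 * (d * k ^ 2) := by gcongr; nlinarith
      rw [hk] at hbrahmagupta
      nlinarith [sq_nonneg (a * x - d * c * y)]
    rw [hk, hk_zero, mul_zero]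
  have hprod : (a * y + b * x) * (a * y + -b * x) = 0 := by
    rcases (Nat.prime_iff_prime_int.mp hp).dvd_or_dvd (Dvd.intro _ hfactor.symm) with h | h
    · rw [eq_zero_of_dvd hab h, zero_mul]
    · rw [eq_zero_of_dvd (by rwa [neg_sq]) h, mul_zero]
  have := (mul_eq_zero.mp (hfactor.symm.trans hprod)).resolve_left hp_pos.ne'
  linarith

theorem sq_ne_one_of_orderOf_eq_four {M : Type*} [Monoid M] {a : M} (ha : orderOf a = 4) :
    a ^ 2 ≠ 1 :=
  pow_ne_one_of_lt_orderOf two_ne_zero (by omega)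

theorem ne_one_of_orderOf_eq_four {M : Type*} [Monoid M] {a : M} (ha : orderOf a = 4) : a ≠ 1 := by
  rintro rfl
  simp at ha

theorem star_one_add_I_div_two : star ((1 + I) / 2) = (1 - I) / 2 := by
  simp [sub_eq_add_neg]

theorem star_one_sub_I_div_two : star ((1 - I) / 2) = (1 + I) / 2 := by
  simp

section QuarticCharacter

variable {F : Type*} [Field F] {χ : MulChar F ℂ}

theorem exists_apply_eq_I_pow [Finite F] (hχ : orderOf χ = 4) {v : F} (hv : v ≠ 0) :
    ∃ c < 4, χ v = I ^ c :=
  MulChar.exists_apply_eq_pow (hχ ▸ pow_orderOf_eq_one χ) isPrimitiveRoot_I hv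

theorem inv_apply_of_apply_eq_I_pow [Finite F] {v : F} {c : ℕ} (hv : χ v = I ^ c) :
    χ⁻¹ v = (-I) ^ c := by
  rw [← MulChar.star_apply', hv, RCLike.star_def, map_pow, conj_I]

theorem exists_jacobiSum_self_eq [Fintype F] (hχ : orderOf χ = 4) :
    ∃ a b : ℤ, jacobiSum χ χ = a + 2 * b * I ∧ (Fintype.card F : ℤ) = a ^ 2 + 4 * b ^ 2 := by
  have hχ4 : χ ^ 4 = 1 := hχ ▸ pow_orderOf_eq_one χ
  obtain ⟨a, b, hJ⟩ : ∃ a b : ℤ, jacobiSum χ χ = a + 2 * b * I := by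
    obtain ⟨z, hz, hJ⟩ := exists_jacobiSum_eq_neg_one_add (by norm_num) hχ4 hχ4
      (hχ ▸ χ.orderOf_dvd_card_sub_one) isPrimitiveRoot_I
    obtain ⟨m, rfl⟩ := exists_gaussianInt_of_mem_adjoin_I hz
    refine ⟨2 * m.im - 1, -m.re, ?_⟩
    rw [hJ, GaussianInt.toComplex_def]
    push_cast
    linear_combination (m.re + m.im * I - 2 * m.im : ℂ) * I_sq
  refine ⟨a, b, hJ, ?_⟩
  have hnorm : ((a : ℂ) + 2 * b * I) * (a - 2 * b * I) = Fintype.card F := by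
    have hJ_star : star (jacobiSum χ χ) = a - 2 * b * I := by simp [hJ, sub_eq_add_neg]
    rw [← hJ, ← hJ_star]
    exact jacobiSum_mul_star (ne_one_of_orderOf_eq_four hχ) (ne_one_of_orderOf_eq_four hχ)
      (sq χ ▸ sq_ne_one_of_orderOf_eq_four hχ)
  have hcard : (Fintype.card F : ℂ) = a ^ 2 + 4 * b ^ 2 := by
    linear_combination -hnorm - (4 * b ^ 2 : ℂ) * I_sq
  exact_mod_cast hcard

theorem abs_im_jacobiSum_self [Fintype F] (hF : (Fintype.card F).Prime) (hχ : orderOf χ = 4)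
    {x y : ℤ} (hxy : (Fintype.card F : ℤ) = x ^ 2 + 4 * y ^ 2) :
    |(jacobiSum χ χ).im| = |2 * (y : ℝ)| := by
  obtain ⟨a, b, hJ, hab⟩ := exists_jacobiSum_self_eq hχ
  have hby : b ^ 2 = y ^ 2 := sq_eq_sq_of_prime_eq_sq_add_mul_sq hF (by norm_num) hab hxy
  have him : (jacobiSum χ χ).im = 2 * b := by simp [hJ]
  have hby_real : (b : ℝ) ^ 2 = y ^ 2 := mod_cast hby
  rw [him, ← sq_eq_sq_iff_abs_eq_abs, mul_pow, mul_pow, hby_real]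

/-- The binary (`±1`-valued) sequence `v ↦ Re ((1 + i) χ v)` of a quartic character `χ`. If
`χ g = i` it is `1` on `H_0 ∪ H_3`, `-1` on `H_1 ∪ H_2` and `0` at `0`. -/
noncomputable def quarticSign (χ : MulChar F ℂ) : F → ℂ :=
  ((1 + I) / 2) • ⇑χ + ((1 - I) / 2) • ⇑χ⁻¹

theorem inv_apply_neg_one (χ : MulChar F ℂ) : χ⁻¹ (-1) = χ (-1) := by
  rw [MulChar.inv_apply', inv_neg_one]

theorem quarticSign_neg (χ : MulChar F ℂ) (v : F) :
    quarticSign χ (-v) = χ (-1) * quarticSign χ v := by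
  simp only [quarticSign, Pi.add_apply, Pi.smul_apply, smul_eq_mul, ← neg_one_mul v, map_mul,
    inv_apply_neg_one]
  ring

theorem quarticSign_of_apply_eq_I_pow [Finite F] {v : F} {c : ℕ} (hv : χ v = I ^ c) :
    quarticSign χ v = (1 + I) / 2 * I ^ c + (1 - I) / 2 * (-I) ^ c := by
  simp only [quarticSign, Pi.add_apply, Pi.smul_apply, smul_eq_mul, hv,
    inv_apply_of_apply_eq_I_pow hv]

theorem exists_sq_apply_eq_and_quarticSign_eq [Finite F] (hχ : orderOf χ = 4) {v : F}
    (hv : v ≠ 0) :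
    ∃ ε δ : ℤ, (ε = 1 ∨ ε = -1) ∧ (δ = 1 ∨ δ = -1) ∧ (χ ^ 2) v = ε ∧ quarticSign χ v = δ := by
  obtain ⟨c, hc4, hc⟩ := exists_apply_eq_I_pow hχ hv
  rw [quarticSign_of_apply_eq_I_pow hc, MulChar.pow_apply' χ two_ne_zero, hc]
  interval_cases c
  · exact ⟨1, 1, .inl rfl, .inl rfl, by norm_num, by push_cast; ring⟩
  · exact ⟨-1, -1, .inr rfl, .inr rfl, by norm_num, by push_cast; linear_combination I_sq⟩
  · exact ⟨1, -1, .inl rfl, .inr rfl, by norm_num, by push_cast; linear_combination I_sq⟩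
  · exact ⟨-1, 1, .inr rfl, .inl rfl, by push_cast; linear_combination (I ^ 4 - I ^ 2 + 1) * I_sq,
      by push_cast; linear_combination (I ^ 2 - 1) * I_sq⟩

theorem quarticSign_zero (χ : MulChar F ℂ) : quarticSign χ 0 = 0 := by
  simp [quarticSign, MulChar.map_zero]

theorem star_quarticSign [Finite F] (χ : MulChar F ℂ) (v : F) :
    star (quarticSign χ v) = quarticSign χ v := by
  simp only [quarticSign, Pi.add_apply, Pi.smul_apply, smul_eq_mul, star_add, star_mul',
    MulChar.star_apply', inv_inv, star_one_add_I_div_two, star_one_sub_I_div_two]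
  ring

variable [Fintype F]

theorem correlation_quarticSign (hχ : orderOf χ = 4) {w : F} (hw : w ≠ 0) :
    correlation (quarticSign χ) (quarticSign χ) w =
      -1 - χ (-1) * (χ ^ 2) w * (jacobiSum χ χ).im := by
  have hχ_ne := ne_one_of_orderOf_eq_four hχ
  have hχ_sq : (χ ^ 2)⁻¹ = χ ^ 2 := by
    rw [inv_eq_iff_mul_eq_one, ← pow_add, ← pow_orderOf_eq_one χ, hχ]
  have hmixed : correlation χ ⇑χ⁻¹ w = χ (-1) * (χ ^ 2) w * jacobiSum χ χ := by
    rw [correlation_mulChar _ _ hw, inv_inv, ← MulChar.mul_apply, sq]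
  have hmixed_inv : correlation ⇑χ⁻¹ χ w = χ (-1) * (χ ^ 2) w * star (jacobiSum χ χ) := by
    rw [correlation_mulChar _ _ hw, jacobiSum_inv_inv, ← MulChar.mul_apply, ← sq, inv_pow, hχ_sq,
      inv_apply_neg_one]
  have hJ : jacobiSum χ χ - star (jacobiSum χ χ) = 2 * (jacobiSum χ χ).im * I := by
    simpa using sub_conj (jacobiSum χ χ)
  simp only [quarticSign, correlation_add_left, correlation_add_right, correlation_smul_left,
    correlation_smul_right, correlation_mulChar_self hχ_ne hw,
    correlation_mulChar_self (inv_ne_one.mpr hχ_ne) hw, hmixed, hmixed_inv,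
    star_one_add_I_div_two, star_one_sub_I_div_two]
  linear_combination I / 2 * χ (-1) * (χ ^ 2) w * hJ + (1 / 2 + χ (-1) * (χ ^ 2) w *
    ((jacobiSum χ χ + star (jacobiSum χ χ)) / 4 + (jacobiSum χ χ).im)) * I_sq

theorem correlation_quarticSign_zero (hχ : orderOf χ = 4) :
    correlation (quarticSign χ) (quarticSign χ) 0 = correlation ⇑(χ ^ 2) ⇑(χ ^ 2) 0 := by
  refine sum_congr rfl fun v _ => ?_
  rw [add_zero]
  by_cases hv : v = 0
  · simp [hv, quarticSign_zero, MulChar.map_zero]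
  · obtain ⟨ε, δ, hε, hδ, hsq, hsign⟩ := exists_sq_apply_eq_and_quarticSign_eq hχ hv
    rw [hsq, hsign]
    rcases hε with rfl | rfl <;> rcases hδ with rfl | rfl <;> simp

/-- The additive character `a ↦ (-1) ^ a` of `ℤ/2`. -/
noncomputable def signChar : AddChar (ZMod 2) ℂ := AddChar.zmodChar 2 neg_one_sq

theorem signChar_natCast (n : ℕ) : signChar n = (-1) ^ n := AddChar.zmodChar_apply' _ n

theorem signChar_ne_one : signChar ≠ 1 := by
  rw [AddChar.zmod_char_ne_one_iff, ← Nat.cast_one, signChar_natCast]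
  norm_num

theorem star_signChar (a : ZMod 2) : star (signChar a) = signChar a := by
  rw [RCLike.star_def, ← AddChar.map_neg_eq_conj, ZModModule.neg_eq_self]

/-- The values `i ^ s` of the quaternary sequence as a function of the residues in `ℤ/2 × F`, where
`F = ℤ/p`. Away from `0` this is the inverse Gray map `((1 + i) a + (1 - i) b) / 2` applied to the
binary sequences `a = χ ^ 2` and `b = ± quarticSign χ`. -/
noncomputable def phase [DecidableEq F] (χ : MulChar F ℂ) (x : ZMod 2 × F) : ℂ :=
  (((1 + I) / 2) • ⇑(χ ^ 2)) x.2 +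
    signChar x.1 * (((1 - I) / 2) • quarticSign χ + (Pi.single 0 1 : F → ℂ)) x.2

theorem correlation_phase [DecidableEq F] (χ : MulChar F ℂ) (b : ZMod 2) (w : F) :
    correlation (phase χ) (phase χ) (b, w) =
      correlation ⇑(χ ^ 2) ⇑(χ ^ 2) w + signChar b * (correlation (quarticSign χ) (quarticSign χ) w
        + (1 + I + (1 - I) * χ (-1)) * quarticSign χ w + 2 * (Pi.single 0 1 : F → ℂ) w) := by
  have hdelta : (Pi.single 0 1 : F → ℂ) (-w) = (Pi.single 0 1 : F → ℂ) w := by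
    simp [Pi.single_apply]
  refine (correlation_prod_addChar signChar_ne_one _ _ b w).trans ?_
  simp only [correlation_add_left, correlation_add_right, correlation_smul_left,
    correlation_smul_right, correlation_single_left, correlation_single_right, zero_add, zero_sub,
    star_quarticSign, star_signChar, star_one_add_I_div_two, star_one_sub_I_div_two, hdelta,
    Pi.add_apply, Pi.smul_apply, smul_eq_mul, quarticSign_neg, ZMod.card, Nat.cast_ofNat]
  linear_combination -(correlation ⇑(χ ^ 2) ⇑(χ ^ 2) w +
    signChar b * correlation (quarticSign χ) (quarticSign χ) w) / 2 * I_sq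

end QuarticCharacter

section Cyclotomic

variable {p : ℕ} {g : ZMod p}

/-- The quaternary sequence of period `2p` of the theorem: `quatSeq` with the class indices
`(j_k) = (0, 2, 1, 3)` and `(l_k) = (2, 0, 3, 1)`. -/
noncomputable abbrev cyclotomicSeq (p : ℕ) (g : ZMod p) : ℕ → ℤ :=
  quatSeq p g ![0, 2, 1, 3] ![2, 0, 3, 1]

theorem natCast_eq_natCast_iff_of_coprime {m k : ℕ} (h : m.Coprime k) (a b : ℕ) :
    (a : ZMod (m * k)) = b ↔ (a : ZMod m) = b ∧ (a : ZMod k) = b := by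
  simp only [ZMod.natCast_eq_natCast_iff]
  exact (Nat.modEq_and_modEq_iff_modEq_mul h).symm

theorem odd_of_natCast_eq_zero_of_lt (hp : Odd p) {w : ℕ} (hw_pos : 0 < w) (hw_lt : w < 2 * p)
    (hw : (w : ZMod p) = 0) : Odd w := by
  obtain ⟨k, rfl⟩ := (ZMod.natCast_eq_zero_iff _ _).mp hw
  have hk_pos : 0 < k := Nat.pos_of_mul_pos_left hw_pos
  have hk_lt : k < 2 := lt_of_mul_lt_mul_left (mul_comm 2 p ▸ hw_lt) p.zero_le
  rwa [show k = 1 by omega, mul_one]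

variable [Fact p.Prime]

theorem isUnit_of_isPrimitiveRoot_sub_one (hg : IsPrimitiveRoot g (p - 1)) : IsUnit g :=
  hg.isUnit (Nat.sub_pos_of_lt (Fact.out : p.Prime).one_lt).ne'

theorem exists_pow_eq_of_isPrimitiveRoot (hg : IsPrimitiveRoot g (p - 1)) {v : ZMod p}
    (hv : v ≠ 0) : ∃ m < p - 1, g ^ m = v :=
  have : NeZero (p - 1) := ⟨(Nat.sub_pos_of_lt (Fact.out : p.Prime).one_lt).ne'⟩
  hg.eq_pow_of_pow_eq_one (ZMod.pow_card_sub_one_eq_one hv)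

theorem exists_mulChar_apply_eq_I (hg : IsPrimitiveRoot g (p - 1)) (hp : 4 ∣ p - 1) :
    ∃ χ : MulChar (ZMod p) ℂ, χ g = I := by
  obtain ⟨u, rfl⟩ := isUnit_of_isPrimitiveRoot_sub_one hg
  have hu (v : (ZMod p)ˣ) : v ∈ Subgroup.zpowers u := by
    obtain ⟨m, -, hm⟩ := exists_pow_eq_of_isPrimitiveRoot hg v.ne_zero
    exact ⟨m, Units.ext (by simpa using hm)⟩
  have hI : Units.mk0 I I_ne_zero ∈ rootsOfUnity (Fintype.card (ZMod p)ˣ) ℂ := by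
    rw [ZMod.card_units, mem_rootsOfUnity']
    exact (isPrimitiveRoot_I.pow_eq_one_iff_dvd _).mpr hp
  exact ⟨MulChar.ofRootOfUnity hI hu, MulChar.ofRootOfUnity_spec hI hu⟩

variable {χ : MulChar (ZMod p) ℂ}

theorem four_dvd_sub_one_of_apply_eq_I (hg : IsPrimitiveRoot g (p - 1)) (hχ : χ g = I) :
    4 ∣ p - 1 :=
  isPrimitiveRoot_I.dvd_of_pow_eq_one _ (by rw [← hχ, ← map_pow, hg.pow_eq_one, map_one])

theorem odd_of_apply_eq_I (hg : IsPrimitiveRoot g (p - 1)) (hχ : χ g = I) : Odd p := by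
  have := four_dvd_sub_one_of_apply_eq_I hg hχ
  have := (Fact.out : p.Prime).two_le
  rw [Nat.odd_iff]
  omega

theorem orderOf_eq_four_of_apply_eq_I (hg : IsPrimitiveRoot g (p - 1)) (hχ : χ g = I) :
    orderOf χ = 4 := by
  have hsq : ¬χ ^ 2 ^ 1 = 1 := by
    intro h
    have hg_unit := isUnit_of_isPrimitiveRoot_sub_one hg
    have h_apply := DFunLike.congr_fun h g
    rw [pow_one, MulChar.pow_apply' χ two_ne_zero, hχ, I_sq, MulChar.one_apply hg_unit] at h_apply
    norm_num at h_apply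
  have hpow_four : χ ^ 2 ^ (1 + 1) = 1 := by
    ext v
    obtain ⟨m, -, hm⟩ := exists_pow_eq_of_isPrimitiveRoot hg v.ne_zero
    rw [MulChar.pow_apply_coe, MulChar.one_apply_coe, ← hm, map_pow, hχ, pow_right_comm]
    norm_num
  exact orderOf_eq_prime_pow hsq hpow_four

theorem apply_neg_one (hg : IsPrimitiveRoot g (p - 1)) (hχ : χ g = I) {k : ℕ}
    (hk : p - 1 = 2 * k) : χ (-1) = I ^ k := by
  have hp := (Fact.out : p.Prime).one_lt
  have hroot : IsPrimitiveRoot (g ^ k) 2 := hg.pow (by omega) (by rw [hk, mul_comm])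
  rw [← hroot.eq_neg_one_of_two_right, map_pow, hχ]

theorem apply_neg_one_of_mod_eight_eq_one (hg : IsPrimitiveRoot g (p - 1)) (hχ : χ g = I)
    (hp : p % 8 = 1) : χ (-1) = 1 := by
  rw [apply_neg_one hg hχ (k := 4 * (p / 8)) (by omega), pow_mul, I_pow_four, one_pow]

theorem apply_neg_one_of_mod_eight_eq_five (hg : IsPrimitiveRoot g (p - 1)) (hχ : χ g = I)
    (hp : p % 8 = 5) : χ (-1) = -1 := by
  rw [apply_neg_one hg hχ (k := 4 * (p / 8) + 2) (by omega), pow_add, pow_mul, I_pow_four, one_pow,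
    one_mul, I_sq]

theorem mem_cycClass_iff (hg : IsPrimitiveRoot g (p - 1)) (hχ : χ g = I) {v : ZMod p} {c : ℕ}
    (hc : c < 4) (hv : χ v = I ^ c) (l : Fin 4) : v ∈ cycClass p g l ↔ c = l := by
  have hp := four_dvd_sub_one_of_apply_eq_I hg hχ
  rw [cycClass, mem_image]
  constructor
  · rintro ⟨t, -, rfl⟩
    rw [map_pow, hχ, pow_add, pow_mul, I_pow_four, one_pow, mul_one] at hv
    exact isPrimitiveRoot_I.pow_inj hc l.2 hv.symm
  · rintro rfl
    have hv_ne : v ≠ 0 := by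
      rintro rfl
      exact pow_ne_zero _ I_ne_zero (hv.symm.trans (MulChar.map_zero χ))
    obtain ⟨m, hm, rfl⟩ := exists_pow_eq_of_isPrimitiveRoot hg hv_ne
    have hmod : m % 4 = l := by
      refine isPrimitiveRoot_I.pow_inj (Nat.mod_lt _ (by norm_num)) hc ?_
      rw [← hv, map_pow, hχ, ← pow_mod_orderOf I m, ← isPrimitiveRoot_I.eq_orderOf]
    exact ⟨m / 4, mem_range.mpr (by omega), by rw [← hmod, Nat.mod_add_div]⟩

theorem I_zpow_cyclotomicSeq (hg : IsPrimitiveRoot g (p - 1)) (hχ : χ g = I) (n : ℕ) :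
    I ^ cyclotomicSeq p g n = phase χ (n, n) := by
  have hodd := odd_of_apply_eq_I hg hχ
  have hcop : Nat.Coprime 2 p := Nat.coprime_two_left.mpr hodd
  have hn_zero : (n : ZMod (2 * p)) = 0 ↔ (n : ZMod 2) = 0 ∧ (n : ZMod p) = 0 := by
    simpa using natCast_eq_natCast_iff_of_coprime hcop n 0
  have hn_p : (n : ZMod (2 * p)) = (p : ZMod (2 * p)) ↔ (n : ZMod 2) = 1 ∧ (n : ZMod p) = 0 := by
    simpa [ZMod.natCast_eq_one_iff_odd.mpr hodd] using natCast_eq_natCast_iff_of_coprime hcop n p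
  have hsign_one : signChar 1 = -1 := by simpa using signChar_natCast 1
  rw [cyclotomicSeq, quatSeq]
  simp only [hn_zero, hn_p, classC, cycClass₂, Set.mem_union, Set.mem_ofPred_eq, map_natCast]
  generalize (n : ZMod 2) = a
  generalize (n : ZMod p) = v
  have ha : a = 0 ∨ a = 1 := by revert a; decide
  by_cases hv : v = 0
  · subst hv
    rcases ha with rfl | rfl <;>
      simp [phase, hsign_one, quarticSign_zero, MulChar.map_zero]
  · obtain ⟨c, hc4, hc⟩ := exists_apply_eq_I_pow (orderOf_eq_four_of_apply_eq_I hg hχ) hv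
    simp only [mem_cycClass_iff hg hχ hc4 hc, hv, phase, Pi.add_apply, Pi.smul_apply, smul_eq_mul,
      Pi.single_apply, if_false, MulChar.pow_apply' χ two_ne_zero, hc,
      quarticSign_of_apply_eq_I_pow hc, Matrix.cons_val]
    interval_cases c <;> rcases ha with rfl | rfl <;>
      norm_num [hsign_one, Complex.ext_iff, pow_succ]

theorem autocorr_cyclotomicSeq (hg : IsPrimitiveRoot g (p - 1)) (hχ : χ g = I) (w : ℕ) :
    autocorr (2 * p) (cyclotomicSeq p g) w = correlation (phase χ) (phase χ) (w, w) := by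
  have := NeZero.mk (Fact.out : p.Prime).ne_zero
  let e := (ZMod.chineseRemainder (Nat.coprime_two_left.mpr (odd_of_apply_eq_I hg hχ))).toAddEquiv
  have he (n : ℕ) : e n = ((n : ZMod 2), (n : ZMod p)) := map_natCast (ZMod.chineseRemainder _) n
  rw [autocorr_eq_correlation (u := phase χ ∘ e) (fun n => ?_), correlation_comp_addEquiv, he]
  rw [I_zpow_cyclotomicSeq hg hχ, Function.comp_apply, he]

theorem autocorr_cyclotomicSeq_of_natCast_ne_zero (hg : IsPrimitiveRoot g (p - 1)) (hχ : χ g = I)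
    {w : ℕ} (hw : (w : ZMod p) ≠ 0) :
    autocorr (2 * p) (cyclotomicSeq p g) w = -1 + (-1) ^ w *
      (-1 - χ (-1) * (χ ^ 2) w * (jacobiSum χ χ).im +
        (1 + I + (1 - I) * χ (-1)) * quarticSign χ w) := by
  have hord := orderOf_eq_four_of_apply_eq_I hg hχ
  rw [autocorr_cyclotomicSeq hg hχ, correlation_phase, signChar_natCast,
    correlation_mulChar_self (sq_ne_one_of_orderOf_eq_four hord) hw,
    correlation_quarticSign hord hw, Pi.single_eq_of_ne hw, mul_zero, add_zero]

theorem autocorr_cyclotomicSeq_of_natCast_eq_zero (hg : IsPrimitiveRoot g (p - 1)) (hχ : χ g = I)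
    {w : ℕ} (hw : (w : ZMod p) = 0) (hw_odd : Odd w) :
    autocorr (2 * p) (cyclotomicSeq p g) w = -2 := by
  rw [autocorr_cyclotomicSeq hg hχ, correlation_phase, signChar_natCast, hw_odd.neg_one_pow, hw,
    correlation_quarticSign_zero (orderOf_eq_four_of_apply_eq_I hg hχ), quarticSign_zero,
    Pi.single_eq_same]
  ring

theorem exists_even_natCast_eq (hp : Odd p) {v : ZMod p} (hv : v ≠ 0) :
    ∃ w : ℕ, 0 < w ∧ w < 2 * p ∧ Even w ∧ (w : ZMod p) = v := by
  have htwo : (2 : ZMod p) ≠ 0 := by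
    exact_mod_cast ((ZMod.isUnit_iff_coprime 2 p).mpr (Nat.coprime_two_left.mpr hp)).ne_zero
  have hcast : ((2 * (v / 2).val : ℕ) : ZMod p) = v := by
    rw [Nat.cast_mul, ZMod.natCast_zmod_val, Nat.cast_ofNat, mul_div_cancel₀ _ htwo]
  refine ⟨2 * (v / 2).val, Nat.pos_of_ne_zero fun h => hv ?_, ?_, even_two_mul _, hcast⟩
  · rw [← hcast, h, Nat.cast_zero]
  · have := (v / 2).val_lt
    omega

theorem exists_even_sq_apply_eq_and_quarticSign_eq_neg_one (hg : IsPrimitiveRoot g (p - 1))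
    (hχ : χ g = I) {ε : ℤ} (hε : ε = 1 ∨ ε = -1) :
    ∃ w : ℕ, 0 < w ∧ w < 2 * p ∧ Even w ∧ (w : ZMod p) ≠ 0 ∧ (χ ^ 2) w = ε ∧
      quarticSign χ w = -1 := by
  have hg_ne : g ≠ 0 := (isUnit_of_isPrimitiveRoot_sub_one hg).ne_zero
  have shift (c : ℕ) : ∃ w : ℕ, 0 < w ∧ w < 2 * p ∧ Even w ∧ (w : ZMod p) ≠ 0 ∧ χ w = I ^ c := by
    obtain ⟨w, hw_pos, hw_lt, hw_even, hw⟩ :=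
      exists_even_natCast_eq (odd_of_apply_eq_I hg hχ) (pow_ne_zero c hg_ne)
    exact ⟨w, hw_pos, hw_lt, hw_even, hw ▸ pow_ne_zero c hg_ne, by rw [hw, map_pow, hχ]⟩
  rcases hε with rfl | rfl
  · obtain ⟨w, hw_pos, hw_lt, hw_even, hw_ne, hw⟩ := shift 2
    refine ⟨w, hw_pos, hw_lt, hw_even, hw_ne, ?_, ?_⟩
    · simp [MulChar.pow_apply' χ two_ne_zero, hw]
    · rw [quarticSign_of_apply_eq_I_pow hw]
      linear_combination I_sq
  · obtain ⟨w, hw_pos, hw_lt, hw_even, hw_ne, hw⟩ := shift 1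
    refine ⟨w, hw_pos, hw_lt, hw_even, hw_ne, ?_, ?_⟩
    · simp [MulChar.pow_apply' χ two_ne_zero, hw]
    · rw [quarticSign_of_apply_eq_I_pow hw]
      linear_combination I_sq

end Cyclotomic

section Maximum

theorem abs_add_sign_mul_le {a b c : ℝ} {ε : ℤ} (hε : ε = 1 ∨ ε = -1) (ha : |a| ≤ b) :
    |a + ε * c| ≤ b + |c| := by
  have hε_abs : |(ε : ℝ)| = 1 := mod_cast (abs_eq zero_le_one).mpr hε
  calc |a + ε * c| ≤ |a| + |ε * c| := abs_add_le _ _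
    _ = |a| + |c| := by rw [abs_mul, hε_abs, one_mul]
    _ ≤ b + |c| := by gcongr

theorem isGreatest_abs_neg_add_sign_mul {b : ℝ} (hb : 0 ≤ b) (c : ℝ) :
    IsGreatest {r : ℝ | ∃ ε : ℤ, (ε = 1 ∨ ε = -1) ∧ r = |-b + ε * c|} (b + |c|) := by
  constructor
  · rcases le_total 0 c with hc | hc
    · refine ⟨-1, .inr rfl, ?_⟩
      rw [abs_of_nonneg hc, abs_of_nonpos (by push_cast; linarith)]
      push_cast
      ring
    · refine ⟨1, .inl rfl, ?_⟩
      rw [abs_of_nonpos hc, abs_of_nonpos (by push_cast; linarith)]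
      push_cast
      ring
  · rintro _ ⟨ε, hε, rfl⟩
    exact abs_add_sign_mul_le hε (by rw [abs_neg, abs_of_nonneg hb])

theorem norm_add_sign_mul_I (a d : ℝ) {δ : ℤ} (hδ : δ = 1 ∨ δ = -1) :
    ‖(a + δ * (d * I) : ℂ)‖ = √(a ^ 2 + d ^ 2) := by
  have hδ_sq : (δ : ℝ) ^ 2 = 1 := by rcases hδ with rfl | rfl <;> norm_num
  have := norm_add_mul_I a (δ * d)
  push_cast at this
  rw [← mul_assoc, this, mul_pow, hδ_sq, one_mul]

theorem isGreatest_norm_neg_add_sign_mul_add {b : ℝ} (hb : 0 ≤ b) (c d : ℝ) :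
    IsGreatest {r : ℝ | ∃ ε δ : ℤ, (ε = 1 ∨ ε = -1) ∧ (δ = 1 ∨ δ = -1) ∧
      r = ‖(-b + ε * c + δ * (d * I) : ℂ)‖} √((b + |c|) ^ 2 + d ^ 2) := by
  have hnorm (ε : ℤ) {δ : ℤ} (hδ : δ = 1 ∨ δ = -1) :
      ‖(-b + ε * c + δ * (d * I) : ℂ)‖ = √(|-b + ε * c| ^ 2 + d ^ 2) := by
    rw [sq_abs, ← norm_add_sign_mul_I _ _ hδ]
    push_cast
    rfl
  obtain ⟨⟨ε, hε, habs⟩, hle⟩ := isGreatest_abs_neg_add_sign_mul hb c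
  constructor
  · exact ⟨ε, 1, hε, .inl rfl, by rw [hnorm ε (.inl rfl), habs]⟩
  · rintro _ ⟨ε, δ, hε, hδ, rfl⟩
    rw [hnorm ε hδ]
    gcongr
    exact hle ⟨ε, hε, rfl⟩

variable {p : ℕ} [Fact p.Prime] {g : ZMod p}

variable {p : ℕ} [Fact p.Prime] {g : ZMod p} {χ : MulChar (ZMod p) ℂ}

theorem norm_autocorr_cyclotomicSeq_of_natCast_eq_zero (hg : IsPrimitiveRoot g (p - 1))
    (hχ : χ g = I) {w : ℕ} (hw_pos : 0 < w) (hw_lt : w < 2 * p) (hw : (w : ZMod p) = 0) :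
    ‖autocorr (2 * p) (cyclotomicSeq p g) w‖ = 2 := by
  have hw_odd := odd_of_natCast_eq_zero_of_lt (odd_of_apply_eq_I hg hχ) hw_pos hw_lt hw
  rw [autocorr_cyclotomicSeq_of_natCast_eq_zero hg hχ hw hw_odd, norm_neg, Complex.norm_ofNat]

theorem exists_autocorr_eq_of_apply_neg_one_eq_one (hg : IsPrimitiveRoot g (p - 1)) (hχ : χ g = I)
    (hneg : χ (-1) = 1) {w : ℕ} (hw : (w : ZMod p) ≠ 0) :
    ∃ (a : ℝ) (ε : ℤ), |a| ≤ 4 ∧ (ε = 1 ∨ ε = -1) ∧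
      autocorr (2 * p) (cyclotomicSeq p g) w = (a + ε * (jacobiSum χ χ).im : ℝ) := by
  obtain ⟨ε, δ, hε, hδ, hsq, hsign⟩ :=
    exists_sq_apply_eq_and_quarticSign_eq (orderOf_eq_four_of_apply_eq_I hg hχ) hw
  rw [autocorr_cyclotomicSeq_of_natCast_ne_zero hg hχ hw, hneg, hsq, hsign]
  rcases neg_one_pow_eq_or ℂ w with hw_sign | hw_sign <;> rw [hw_sign]
  · refine ⟨-2 + 2 * δ, -ε, ?_, by omega, by push_cast; ring⟩
    rcases hδ with rfl | rfl <;> norm_num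
  · refine ⟨-(2 * δ), ε, ?_, hε, by push_cast; ring⟩
    rcases hδ with rfl | rfl <;> norm_num

theorem exists_autocorr_eq_of_apply_neg_one_eq_neg_one (hg : IsPrimitiveRoot g (p - 1))
    (hχ : χ g = I) (hneg : χ (-1) = -1) {w : ℕ} (hw : (w : ZMod p) ≠ 0) :
    ∃ (a : ℝ) (ε δ : ℤ), |a| ≤ 2 ∧ (ε = 1 ∨ ε = -1) ∧ (δ = 1 ∨ δ = -1) ∧
      autocorr (2 * p) (cyclotomicSeq p g) w =
        (a + ε * (jacobiSum χ χ).im : ℝ) + δ * ((2 : ℝ) * I) := by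
  obtain ⟨ε, δ, hε, hδ, hsq, hsign⟩ :=
    exists_sq_apply_eq_and_quarticSign_eq (orderOf_eq_four_of_apply_eq_I hg hχ) hw
  rw [autocorr_cyclotomicSeq_of_natCast_ne_zero hg hχ hw, hneg, hsq, hsign]
  rcases neg_one_pow_eq_or ℂ w with hw_sign | hw_sign <;> rw [hw_sign]
  · exact ⟨-2, ε, δ, by norm_num, hε, hδ, by push_cast; ring⟩
  · exact ⟨0, -ε, -δ, by norm_num, by omega, by omega, by push_cast; ring⟩

theorem isGreatest_nontrivialMagnitudes_of_apply_neg_one_eq_one (hg : IsPrimitiveRoot g (p - 1))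
    (hχ : χ g = I) (hneg : χ (-1) = 1) :
    IsGreatest (nontrivialMagnitudes (2 * p) (cyclotomicSeq p g))
      (4 + |(jacobiSum χ χ).im|) := by
  constructor
  · obtain ⟨ε, hε, habs⟩ :=
      (isGreatest_abs_neg_add_sign_mul zero_le_four (jacobiSum χ χ).im).1
    obtain ⟨w, hw_pos, hw_lt, hw_even, hw, hsq, hsign⟩ :=
      exists_even_sq_apply_eq_and_quarticSign_eq_neg_one hg hχ (ε := -ε) (by omega)
    have hvalue : autocorr (2 * p) (cyclotomicSeq p g) w =
        (-4 + ε * (jacobiSum χ χ).im : ℝ) := by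
      rw [autocorr_cyclotomicSeq_of_natCast_ne_zero hg hχ hw, hneg, hsq, hsign,
        hw_even.neg_one_pow]
      push_cast
      ring
    exact ⟨w, hw_pos, hw_lt, by rw [hvalue, norm_real, Real.norm_eq_abs, habs]⟩
  · rintro _ ⟨w, hw_pos, hw_lt, rfl⟩
    by_cases hw : (w : ZMod p) = 0
    · rw [norm_autocorr_cyclotomicSeq_of_natCast_eq_zero hg hχ hw_pos hw_lt hw]
      linarith [abs_nonneg (jacobiSum χ χ).im]
    · obtain ⟨a, ε, ha, hε, hvalue⟩ := exists_autocorr_eq_of_apply_neg_one_eq_one hg hχ hneg hw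
      rw [hvalue, norm_real, Real.norm_eq_abs]
      exact abs_add_sign_mul_le hε ha

theorem isGreatest_nontrivialMagnitudes_of_apply_neg_one_eq_neg_one
    (hg : IsPrimitiveRoot g (p - 1)) (hχ : χ g = I) (hneg : χ (-1) = -1) :
    IsGreatest (nontrivialMagnitudes (2 * p) (cyclotomicSeq p g))
      √((2 + |(jacobiSum χ χ).im|) ^ 2 + 2 ^ 2) := by
  constructor
  · obtain ⟨ε, hε, habs⟩ :=
      (isGreatest_abs_neg_add_sign_mul zero_le_two (jacobiSum χ χ).im).1
    obtain ⟨w, hw_pos, hw_lt, hw_even, hw, hsq, hsign⟩ :=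
      exists_even_sq_apply_eq_and_quarticSign_eq_neg_one hg hχ hε
    have hvalue : autocorr (2 * p) (cyclotomicSeq p g) w =
        (-2 + ε * (jacobiSum χ χ).im : ℝ) + (-1 : ℤ) * ((2 : ℝ) * I) := by
      rw [autocorr_cyclotomicSeq_of_natCast_ne_zero hg hχ hw, hneg, hsq, hsign,
        hw_even.neg_one_pow]
      push_cast
      ring
    exact ⟨w, hw_pos, hw_lt, by rw [hvalue, norm_add_sign_mul_I _ _ (.inr rfl), habs, sq_abs]⟩
  · rintro _ ⟨w, hw_pos, hw_lt, rfl⟩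
    by_cases hw : (w : ZMod p) = 0
    · rw [norm_autocorr_cyclotomicSeq_of_natCast_eq_zero hg hχ hw_pos hw_lt hw]
      exact Real.le_sqrt_of_sq_le (le_add_of_nonneg_left (sq_nonneg _))
    · obtain ⟨a, ε, δ, ha, hε, hδ, hvalue⟩ :=
        exists_autocorr_eq_of_apply_neg_one_eq_neg_one hg hχ hneg hw
      rw [hvalue, norm_add_sign_mul_I _ _ hδ, ← sq_abs (a + _)]
      gcongr
      exact abs_add_sign_mul_le hε ha

end Maximum

end QuaternaryCyclotomic

theorem lemma3 (p : ℕ) (hp : p.Prime) (g : ZMod p) (hg : IsPrimitiveRoot g (p - 1))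
    (x y : ℤ) (hxy : (p : ℤ) = x ^ 2 + 4 * y ^ 2) (hx : x ≡ 1 [ZMOD 4]) :
    (p ≡ 5 [MOD 8] →
      ∃ M : ℝ,
        IsGreatest (QuaternaryCyclotomic.nontrivialMagnitudes (2 * p)
          (QuaternaryCyclotomic.quatSeq p g ![0, 2, 1, 3] ![2, 0, 3, 1])) M ∧
        IsGreatest {r : ℝ | ∃ ε δ : ℤ, (ε = 1 ∨ ε = -1) ∧ (δ = 1 ∨ δ = -1) ∧
          r = ‖(-2 + (ε : ℂ) * (2 * (y : ℂ)) + (δ : ℂ) * (2 * Complex.I) : ℂ)‖} M) ∧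
    (p ≡ 1 [MOD 8] →
      ∃ M : ℝ,
        IsGreatest (QuaternaryCyclotomic.nontrivialMagnitudes (2 * p)
          (QuaternaryCyclotomic.quatSeq p g ![0, 2, 1, 3] ![2, 0, 3, 1])) M ∧
        IsGreatest {r : ℝ | ∃ ε : ℤ, (ε = 1 ∨ ε = -1) ∧
          r = |(-4 + (ε : ℝ) * (2 * (y : ℝ)) : ℝ)|} M) := by
  have := Fact.mk hp
  have im_eq {χ : MulChar (ZMod p) ℂ} (hχ : χ g = Complex.I) :
      |(jacobiSum χ χ).im| = |2 * (y : ℝ)| :=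
    QuaternaryCyclotomic.abs_im_jacobiSum_self (by rwa [ZMod.card])
      (QuaternaryCyclotomic.orderOf_eq_four_of_apply_eq_I hg hχ) (by rwa [ZMod.card])
  constructor <;> intro (h8 : p % 8 = _) <;>
    obtain ⟨χ, hχ⟩ := QuaternaryCyclotomic.exists_mulChar_apply_eq_I hg (by omega)
  · refine ⟨_, QuaternaryCyclotomic.isGreatest_nontrivialMagnitudes_of_apply_neg_one_eq_neg_one
      hg hχ (QuaternaryCyclotomic.apply_neg_one_of_mod_eight_eq_five hg hχ h8), ?_⟩
    simpa [im_eq hχ] using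
      QuaternaryCyclotomic.isGreatest_norm_neg_add_sign_mul_add zero_le_two (2 * y) 2
  · refine ⟨_, QuaternaryCyclotomic.isGreatest_nontrivialMagnitudes_of_apply_neg_one_eq_one
      hg hχ (QuaternaryCyclotomic.apply_neg_one_of_mod_eight_eq_one hg hχ h8), ?_⟩
    rw [im_eq hχ]
    exact QuaternaryCyclotomic.isGreatest_abs_neg_add_sign_mul zero_le_four (2 * y)
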